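/- Let $V$ be a rational vector space of dimension $n$ and let $(V,h,Q)$ be a polarized rational Hodge structure of weight $2$ with Hodge decomposition $V_{\mathbf C}=V^{2,0}\oplus V^{1,1}\oplus V^{0,2}$ and $\dim V^{2,0}=1$. Here $h:\mathbf C^*\to GL(V_{\mathbf R})$ is the representation defining the Hodge structure, $V^{p,q}=\{x\in V_{\mathbf C}: h(z)x=z^p\bar z^q x \text{ for all } z\in\mathbf C^*\}$, and a polarization of a weight $k$ Hodge structure $(W,h_W)$ is a bilinear form $\Psi:W\times W\to\mathbf Q$ such that, after real bilinear extension, $\Psi(h_W(z)v,h_W(z)w)=(z\bar z)^k\Psi(v,w)$ for all $z\in\mathbf C^*$ and $v,w\in W_{\mathbf R}$, and $(v,w)\mapsto\Psi(v,h_W(i)w)$ is symmetric and positive definite on $W_{\mathbf R}$. Write $Q(v)=Q(v,v)$, and let $e_1,\dots,e_n$ be a basis of $V$ in which $Q=d_1X_1^2+\dots+d_nX_n^2$ with $d_1,d_2<0$ and $d_3,\dots,d_n>0$. Let $C(Q)$ be the Clifford algebra of $Q$ (with $v\cdot v=Q(v)$), $C^+(Q)$ its even subalgebra, $\iota$ the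 anti-involution of $C^+(Q)$ with $\iota(e_1^{a_1}\cdots e_n^{a_n})=e_n^{a_n}\cdots e_1^{a_1}$ for $a_i\in\{0,1\}$, $\sum a_i$ even, and $Tr(c)$ the trace of the linear map $x\mapsto cx$ on $C^+(Q)$. Then there are $f_1,f_2\in V_{\mathbf R}$ with $V^{2,0}=\langle f_1+if_2\rangle_{\mathbf C}$ and $Q(f_1)=-1$, and there is a sign $\varepsilon\in\{1,-1\}$ such that for every such pair $f_1,f_2$ the following holds. Put $J=f_1f_2\in C^+(Q)_{\mathbf R}$ and $h_s(a+bi)x=(a-bJ)x$ for $a+bi\in\mathbf C^*$, $x\in C^+(Q)_{\mathbf R}$. Then $h_s$ defines a rational Hodge structure of weight one on $C^+(Q)$ (with $C^+(Q)_{\mathbf C}$ the sum of its $(1,0)$ and $(0,1)$ parts), and with $\alpha=\varepsilon e_1e_2\in C^+(Q)$ the bilinear form $$E:C^+(Q)\times C^+(Q)\to\mathbf Q,\qquad E(v,w)=Tr(\alpha\,\iota(v)\,w),$$ is a polarization of the weight one Hodge structure $(C^+(Q),h_s)$. -/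

import Mathlib

open scoped TensorProduct

namespace KugaSatake

noncomputable section

/-- The scalar extension `V_ℝ = V ⊗_ℚ ℝ` of a rational vector space. -/
abbrev RealExt (V : Type*) [AddCommGroup V] [Module ℚ V] : Type _ := ℝ ⊗[ℚ] V

/-- The complexification `V_ℂ`, taken as the complexification of `V_ℝ`. -/
abbrev CplxExt (V : Type*) [AddCommGroup V] [Module ℚ V] : Type _ := ℂ ⊗[ℝ] RealExt V

/-- Complex conjugation `z ⊗ v ↦ z̄ ⊗ v` on `V_ℂ`. -/
def conj (V : Type*) [AddCommGroup V] [Module ℚ V] : CplxExt V →ₗ[ℝ] CplxExt V :=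
  LinearMap.rTensor (RealExt V) Complex.conjAe.toLinearMap

/-- The subspace `V^{p,q} = {x ∈ V_ℂ : h(z) x = z^p z̄^q x for all z ∈ ℂ^*}`. -/
def hodgeComponent {V : Type*} [AddCommGroup V] [Module ℚ V]
    (h : ℂˣ → Module.End ℝ (RealExt V)) (p q : ℕ) : Submodule ℂ (CplxExt V) :=
  ⨅ z : ℂˣ, Module.End.eigenspace ((h z).baseChange ℂ)
    ((z : ℂ) ^ p * (starRingEnd ℂ (z : ℂ)) ^ q)

/-- `h` is a (group) representation of `ℂ^*` on `V_ℝ` which defines a rational Hodge structure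
of weight `k` on `V`: `V_ℂ` is the direct sum of the `V^{p,q}` with `p + q = k`, `p, q ≥ 0`,
and complex conjugation exchanges `V^{p,q}` and `V^{q,p}`. -/
structure IsHodgeStructure {V : Type*} [AddCommGroup V] [Module ℚ V] (k : ℕ)
    (h : ℂˣ → Module.End ℝ (RealExt V)) : Prop where
  map_one : h 1 = 1
  map_mul : ∀ z w : ℂˣ, h (z * w) = h z * h w
  isInternal : DirectSum.IsInternal (fun p : Fin (k + 1) => hodgeComponent h (p : ℕ) (k - p))
  conj_mem : ∀ p q : ℕ, p + q = k →
    ∀ x : CplxExt V, x ∈ hodgeComponent h p q ↔ conj V x ∈ hodgeComponent h q p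

/-- The imaginary unit as an element of `ℂ^*`. -/
def unitI : ℂˣ := Units.mk0 Complex.I Complex.I_ne_zero

/-- `Ψ` is a polarization of the Hodge structure `(V, h)` of weight `k`. The real bilinear
extension of `Ψ` to `V_ℝ` is `Ψ.baseChange ℝ`. -/
structure IsPolarization {V : Type*} [AddCommGroup V] [Module ℚ V] (k : ℕ)
    (h : ℂˣ → Module.End ℝ (RealExt V)) (Ψ : LinearMap.BilinForm ℚ V) : Prop where
  equivariant : ∀ (z : ℂˣ) (v w : RealExt V),
    Ψ.baseChange ℝ (h z v) (h z w) = Complex.normSq (z : ℂ) ^ k * Ψ.baseChange ℝ v w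
  symm : ∀ v w : RealExt V, Ψ.baseChange ℝ v (h unitI w) = Ψ.baseChange ℝ w (h unitI v)
  pos : ∀ v : RealExt V, v ≠ 0 → 0 < Ψ.baseChange ℝ v (h unitI v)

/-- The quadratic form `Q(v) = Q(v, v)` of a bilinear form. -/
abbrev quadForm {V : Type*} [AddCommGroup V] [Module ℚ V] (Q : LinearMap.BilinForm ℚ V) :
    QuadraticForm ℚ V :=
  LinearMap.BilinMap.toQuadraticMap Q

/-- The even Clifford algebra `C⁺(Q)`, with the convention `v * v = Q(v, v)` in `C(Q)`. -/
abbrev CPlus {V : Type*} [AddCommGroup V] [Module ℚ V] (Q : LinearMap.BilinForm ℚ V) : Type _ :=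
  CliffordAlgebra.even (quadForm Q)

/-- The product `v * w ∈ C⁺(Q)` of two vectors of `V`. -/
def vecMul {V : Type*} [AddCommGroup V] [Module ℚ V] (Q : LinearMap.BilinForm ℚ V) :
    V →ₗ[ℚ] V →ₗ[ℚ] CPlus Q :=
  (CliffordAlgebra.even.ι (quadForm Q)).bilin

/-- The product `f * g ∈ C⁺(Q)_ℝ` of two vectors of `V_ℝ`: the `ℝ`-bilinear extension of the
product of vectors of `V`. -/
def realVecMul {V : Type*} [AddCommGroup V] [Module ℚ V] (Q : LinearMap.BilinForm ℚ V) :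
    RealExt V →ₗ[ℝ] RealExt V →ₗ[ℝ] RealExt (CPlus Q) :=
  LinearMap.BilinMap.baseChange ℝ (vecMul Q)

/-- `f₁, f₂ ∈ V_ℝ` satisfy `V^{2,0} = ⟨f₁ + i f₂⟩` and `Q(f₁) = -1`. -/
structure IsAdapted {V : Type*} [AddCommGroup V] [Module ℚ V]
    (h : ℂˣ → Module.End ℝ (RealExt V)) (Q : LinearMap.BilinForm ℚ V)
    (f₁ f₂ : RealExt V) : Prop where
  span_eq : hodgeComponent h 2 0 =
    Submodule.span ℂ {(1 : ℂ) ⊗ₜ[ℝ] f₁ + Complex.I ⊗ₜ[ℝ] f₂}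
  norm_eq : Q.baseChange ℝ f₁ f₁ = -1

/-- For `J ∈ C⁺(Q)_ℝ`, the map sending `z = a + bi` to the map `x ↦ (a - bJ) x` on
`C⁺(Q)_ℝ`. -/
def hS {V : Type*} [AddCommGroup V] [Module ℚ V] (Q : LinearMap.BilinForm ℚ V)
    (J : RealExt (CPlus Q)) (z : ℂˣ) : Module.End ℝ (RealExt (CPlus Q)) :=
  LinearMap.mulLeft ℝ ((z : ℂ).re • (1 : RealExt (CPlus Q)) - (z : ℂ).im • J)

/-- The trace `Tr(c)` of the map `x ↦ c x` on `C⁺(Q)`. -/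
def Tr {V : Type*} [AddCommGroup V] [Module ℚ V] (Q : LinearMap.BilinForm ℚ V) :
    CPlus Q →ₗ[ℚ] ℚ :=
  LinearMap.trace ℚ (CPlus Q) ∘ₗ (Algebra.lmul ℚ (CPlus Q)).toLinearMap

/-- The anti-involution `ι` of `C⁺(Q)`, reversing products of vectors. -/
def iota {V : Type*} [AddCommGroup V] [Module ℚ V] (Q : LinearMap.BilinForm ℚ V) :
    CPlus Q →ₗ[ℚ] CPlus Q :=
  (CliffordAlgebra.reverse (Q := quadForm Q)).restrict
    (p := Subalgebra.toSubmodule (CliffordAlgebra.even (quadForm Q)))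
    (q := Subalgebra.toSubmodule (CliffordAlgebra.even (quadForm Q)))
    (fun x hx => (CliffordAlgebra.reverse_mem_evenOdd_iff (x := x)).2 hx)

/-- The bilinear form `E(v, w) = Tr(α ι(v) w)` on `C⁺(Q)`. -/
def formE {V : Type*} [AddCommGroup V] [Module ℚ V] (Q : LinearMap.BilinForm ℚ V)
    (α : CPlus Q) : LinearMap.BilinForm ℚ (CPlus Q) :=
  LinearMap.mk₂ ℚ (fun v w => Tr Q (α * iota Q v * w))
    (fun v v' w => by simp [mul_add, add_mul])
    (fun c v w => by simp)
    (fun v w w' => by simp [mul_add])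
    (fun c v w => by simp)

end

end KugaSatake

/-! The algebraic axioms need only `J * J = -1`, `ι(J) = -J` and `ι(α) = -α`. The first gives the
weight one structure. The first two give `ι(a - bJ)(a - bJ) = a² + b²`, hence equivariance. Symmetry
follows from the last two because `Tr` is cyclic and invariant under `ι`. As `h_s(i)` is
multiplication by `-J`, positivity says that `Tr(α ι(v) J v)` is negative for `v ≠ 0`, and this is
the real content.

For `J = α = e₁e₂` the form is diagonal in the basis of even monomials: a monomial has nonzero trace
only if every index occurs an even number of times, and the signs of the `d_i` make the diagonal
entries negative (`traceNegDef_vecMul`).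

Definiteness is then carried from one negative plane to another without any connectedness argument.
If `J = pf` and `J' = qf` share a vector `f`, then `g = 1 - JJ'` satisfies `Jg = gJ'` and `g ι(g) =
2 - 2Q(p,q)`. Substituting `ι(g)v` for `v` turns the form of `J'` into a multiple of that of `J`,
positive when `Q(p,q) ≤ 0` (`TraceNegDef.of_nonpos`). Otherwise `p` is replaced by `-p`, which only
changes the sign of `J`. Two such moves link `⟨e₁, e₂⟩` to `⟨f₁, f₂⟩`
(`TraceDefinite.of_orthonormal`). The resulting sign is absorbed in `ε`, uniformly in the pair,
since `f₁f₂` depends only on the Hodge structure and `Q` (`IsAdapted.realVecMul_eq`). -/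

namespace KugaSatake

noncomputable section

/-! ### Monomials in orthogonal vectors, up to scalars. -/

section Monomials

variable {K V I : Type*} [Field K] [AddCommGroup V] [Module K V]
  (Q : QuadraticForm K V) (e : I → V)

/-- The product in the Clifford algebra of the vectors `e i`, `i` running through a list. -/
def cliffordMonomial (l : List I) : CliffordAlgebra Q :=
  (l.map fun i => CliffordAlgebra.ι Q (e i)).prod

@[simp] lemma cliffordMonomial_nil : cliffordMonomial Q e [] = 1 := rfl

@[simp] lemma cliffordMonomial_cons (i : I) (l : List I) :
    cliffordMonomial Q e (i :: l) = CliffordAlgebra.ι Q (e i) * cliffordMonomial Q e l := rfl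

lemma cliffordMonomial_append (l l' : List I) :
    cliffordMonomial Q e (l ++ l') = cliffordMonomial Q e l * cliffordMonomial Q e l' := by
  simp [cliffordMonomial]

lemma reverse_cliffordMonomial (l : List I) :
    CliffordAlgebra.reverse (cliffordMonomial Q e l) = cliffordMonomial Q e l.reverse := by
  induction l with
  | nil => simp
  | cons i l ih => simp [ih, cliffordMonomial_append]

lemma cliffordMonomial_mem_evenOdd (l : List I) :
    cliffordMonomial Q e l ∈ CliffordAlgebra.evenOdd Q (l.length : ZMod 2) := by
  induction l with
  | nil => simpa using SetLike.one_mem_graded (CliffordAlgebra.evenOdd Q)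
  | cons i l ih =>
    have := SetLike.mul_mem_graded (CliffordAlgebra.ι_mem_evenOdd_one Q (e i)) ih
    simpa [add_comm] using this

variable {Q e}

/-- Orthogonal vectors anticommute, so the scalar is a sign. Its value is never needed: the trace
arguments only use which basis monomial appears. -/
lemma exists_cliffordMonomial_eq_of_perm (he : ∀ i j, i ≠ j → Q.IsOrtho (e i) (e j))
    {l l' : List I} (h : l.Perm l') :
    ∃ c : K, cliffordMonomial Q e l = c • cliffordMonomial Q e l' := by
  induction h with
  | nil => exact ⟨1, by simp⟩
  | cons i _ ih =>
    obtain ⟨c, hc⟩ := ih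
    exact ⟨c, by simp [hc]⟩
  | swap i j l =>
    by_cases hij : j = i
    · subst hij
      exact ⟨1, by simp⟩
    · refine ⟨-1, ?_⟩
      simp only [cliffordMonomial_cons, ← mul_assoc]
      rw [CliffordAlgebra.ι_mul_ι_comm_of_isOrtho (he j i hij)]
      simp
  | trans _ _ ih ih' =>
    obtain ⟨c, hc⟩ := ih
    obtain ⟨d, hd⟩ := ih'
    exact ⟨c * d, by rw [hc, hd, mul_smul]⟩

variable [LinearOrder I]

/-- The indices which occur an odd number of times in a list. -/
def oddSupport (l : List I) : Finset I := l.foldr (fun i s => symmDiff {i} s) ∅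

@[simp] lemma oddSupport_nil : oddSupport ([] : List I) = ∅ := rfl

@[simp] lemma oddSupport_cons (i : I) (l : List I) :
    oddSupport (i :: l) = symmDiff {i} (oddSupport l) := rfl

lemma oddSupport_append (l l' : List I) :
    oddSupport (l ++ l') = symmDiff (oddSupport l) (oddSupport l') := by
  induction l with
  | nil => simp [← Finset.bot_eq_empty]
  | cons i l ih => simp [ih, symmDiff_assoc]

lemma oddSupport_reverse (l : List I) : oddSupport l.reverse = oddSupport l := by
  induction l with
  | nil => rfl
  | cons i l ih =>
    simp only [List.reverse_cons, oddSupport_append, ih, oddSupport_cons, oddSupport_nil]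
    rw [← Finset.bot_eq_empty, symmDiff_bot, symmDiff_comm]

lemma oddSupport_eq_toFinset {l : List I} (h : l.Nodup) : oddSupport l = l.toFinset := by
  induction l with
  | nil => rfl
  | cons i l ih =>
    rw [List.nodup_cons] at h
    rw [oddSupport_cons, ih h.2, List.toFinset_cons]
    ext j
    simp only [Finset.mem_symmDiff, Finset.mem_singleton, List.mem_toFinset, Finset.mem_insert]
    grind

lemma oddSupport_sort (S : Finset I) : oddSupport S.sort = S := by
  rw [oddSupport_eq_toFinset (Finset.sort_nodup _ _), Finset.sort_toFinset]

/-- If `i` is absent from `S` it is sorted into place. If present, its factor is brought to the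
front and `e i` squares to a scalar. -/
lemma exists_ι_mul_cliffordMonomial_sort (he : ∀ i j, i ≠ j → Q.IsOrtho (e i) (e j))
    (i : I) (S : Finset I) :
    ∃ c : K, CliffordAlgebra.ι Q (e i) * cliffordMonomial Q e S.sort =
      c • cliffordMonomial Q e (symmDiff {i} S).sort := by
  by_cases hi : i ∈ S
  · have hperm : S.sort.Perm (i :: (symmDiff {i} S).sort) := by
      refine (List.perm_ext_iff_of_nodup (Finset.sort_nodup _ _) ?_).2 ?_
      · simp [Finset.mem_symmDiff, hi]
      · intro j
        simp only [Finset.mem_sort, List.mem_cons, Finset.mem_symmDiff, Finset.mem_singleton]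
        grind
    obtain ⟨c, hc⟩ := exists_cliffordMonomial_eq_of_perm he hperm
    refine ⟨c * Q (e i), ?_⟩
    rw [hc, cliffordMonomial_cons, mul_smul_comm, ← mul_assoc, CliffordAlgebra.ι_sq_scalar,
      ← Algebra.smul_def, smul_smul]
  · have hperm : (i :: S.sort).Perm (symmDiff {i} S).sort := by
      refine (List.perm_ext_iff_of_nodup ?_ (Finset.sort_nodup _ _)).2 ?_
      · simp [hi]
      · intro j
        simp only [Finset.mem_sort, List.mem_cons, Finset.mem_symmDiff, Finset.mem_singleton]
        grind
    exact exists_cliffordMonomial_eq_of_perm he hperm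

lemma exists_cliffordMonomial_eq (he : ∀ i j, i ≠ j → Q.IsOrtho (e i) (e j)) (l : List I) :
    ∃ c : K, cliffordMonomial Q e l = c • cliffordMonomial Q e (oddSupport l).sort := by
  induction l with
  | nil => exact ⟨1, by simp⟩
  | cons i l ih =>
    obtain ⟨c, hc⟩ := ih
    obtain ⟨d, hd⟩ := exists_ι_mul_cliffordMonomial_sort he i (oddSupport l)
    exact ⟨c * d, by rw [cliffordMonomial_cons, hc, mul_smul_comm, hd, smul_smul, oddSupport_cons]⟩

end Monomials

/-! ### Monomial bases of the full and even Clifford algebras, and traces of monomials. -/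

section Basis

variable {K V I : Type*} [Field K] [AddCommGroup V] [Module K V]
  {Q : QuadraticForm K V}

lemma cliffordMonomial_mem_even (e : I → V) {l : List I} (hl : Even l.length) :
    cliffordMonomial Q e l ∈ CliffordAlgebra.even Q := by
  have := cliffordMonomial_mem_evenOdd Q e l
  rwa [(ZMod.natCast_eq_zero_iff_even).2 hl] at this

variable [LinearOrder I] [Fintype I] (e : Module.Basis I K V)

lemma span_cliffordMonomial_sort (he : ∀ i j, i ≠ j → Q.IsOrtho (e i) (e j)) :
    Submodule.span K (Set.range fun S : Finset I => cliffordMonomial Q e S.sort) = ⊤ := by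
  set W := Submodule.span K (Set.range fun S : Finset I => cliffordMonomial Q e S.sort) with hW
  have hmul : ∀ (v : V) (x : CliffordAlgebra Q), x ∈ W → CliffordAlgebra.ι Q v * x ∈ W := by
    intro v x hx
    induction hx using Submodule.span_induction with
    | mem x hx =>
      obtain ⟨S, rfl⟩ := hx
      rw [← e.sum_repr v]
      simp only [map_sum, map_smul, Finset.sum_mul, smul_mul_assoc]
      refine W.sum_mem fun i _ => W.smul_mem _ ?_
      obtain ⟨c, hc⟩ := exists_ι_mul_cliffordMonomial_sort he i S
      rw [hc]
      exact W.smul_mem _ (Submodule.subset_span ⟨_, rfl⟩)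
    | zero => simp
    | add x y _ _ hx hy => rw [mul_add]; exact W.add_mem hx hy
    | smul c x _ hx => rw [mul_smul_comm]; exact W.smul_mem _ hx
  have hone : (1 : CliffordAlgebra Q) ∈ W := Submodule.subset_span ⟨∅, by simp⟩
  have hall : ∀ a x : CliffordAlgebra Q, x ∈ W → a * x ∈ W := by
    intro a
    induction a using CliffordAlgebra.induction with
    | algebraMap r => intro x hx; rw [← Algebra.smul_def]; exact W.smul_mem _ hx
    | ι v => exact hmul v
    | mul a b ha hb => intro x hx; rw [mul_assoc]; exact ha _ (hb _ hx)
    | add a b ha hb => intro x hx; rw [add_mul]; exact W.add_mem (ha _ hx) (hb _ hx)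
  exact eq_top_iff.2 fun a _ => by simpa using hall a 1 hone

variable [Invertible (2 : K)]

lemma finrank_cliffordAlgebra (Q : QuadraticForm K V) (e : Module.Basis I K V) :
    Module.finrank K (CliffordAlgebra Q) = Fintype.card (Finset I) := by
  rw [← Module.finrank_eq_card_basis (Module.Basis.ExteriorAlgebra e)]
  exact LinearEquiv.finrank_eq (CliffordAlgebra.equivExterior Q)

/-- A spanning family whose cardinality is the dimension; the dimension comes from the linear
isomorphism with the exterior algebra, which uses that `2` is invertible. -/
lemma linearIndependent_cliffordMonomial_sort (he : ∀ i j, i ≠ j → Q.IsOrtho (e i) (e j)) :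
    LinearIndependent K fun S : Finset I => cliffordMonomial Q e S.sort := by
  apply linearIndependent_of_top_le_span_of_card_eq_finrank
  · exact (span_cliffordMonomial_sort e he).ge
  · exact (finrank_cliffordAlgebra Q e).symm

/-- The basis of a Clifford algebra attached to an orthogonal basis. -/
def cliffordBasis (he : ∀ i j, i ≠ j → Q.IsOrtho (e i) (e j)) :
    Module.Basis (Finset I) K (CliffordAlgebra Q) :=
  Module.Basis.mk (linearIndependent_cliffordMonomial_sort e he)
    (span_cliffordMonomial_sort e he).ge

@[simp] lemma cliffordBasis_apply (he : ∀ i j, i ≠ j → Q.IsOrtho (e i) (e j)) (S : Finset I) :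
    cliffordBasis e he S = cliffordMonomial Q e S.sort := by
  simp [cliffordBasis]

/-- The monomials with an even number of factors, as elements of the even subalgebra. -/
def evenMonomial (S : {S : Finset I // Even S.card}) : CliffordAlgebra.even Q :=
  ⟨cliffordMonomial Q e S.1.sort, cliffordMonomial_mem_even e (by simpa using S.2)⟩

lemma linearIndependent_evenMonomial (he : ∀ i j, i ≠ j → Q.IsOrtho (e i) (e j)) :
    LinearIndependent K (evenMonomial (Q := Q) e) := by
  refine LinearIndependent.of_comp (CliffordAlgebra.even Q).val.toLinearMap ?_
  have := (cliffordBasis e he).linearIndependent.comp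
    (Subtype.val : {S : Finset I // Even S.card} → Finset I) Subtype.val_injective
  convert this using 1
  ext S
  simp [evenMonomial]

lemma span_evenMonomial (he : ∀ i j, i ≠ j → Q.IsOrtho (e i) (e j)) :
    Submodule.span K (Set.range (evenMonomial (Q := Q) e)) = ⊤ := by
  refine eq_top_iff.2 fun x _ => ?_
  set b := cliffordBasis e he
  set y : CliffordAlgebra.even Q :=
    ∑ S : {S : Finset I // Even S.card}, b.repr x S.1 • evenMonomial e S with hy
  -- The difference collects the odd monomials of the expansion of `x`, yet it is even, so it
  -- vanishes.
  have hodd : (x : CliffordAlgebra Q) - y ∈ CliffordAlgebra.evenOdd Q 1 := by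
    have hsum : (x : CliffordAlgebra Q) - y =
        ∑ S ∈ Finset.univ.filter (fun S : Finset I => ¬ Even S.card),
          b.repr x S • cliffordMonomial Q e S.sort := by
      have h1 : (y : CliffordAlgebra Q) =
          ∑ S ∈ Finset.univ.filter (fun S : Finset I => Even S.card),
            b.repr x S • cliffordMonomial Q e S.sort := by
        rw [hy, AddSubmonoidClass.coe_finsetSum,
          Finset.sum_subtype (p := fun S : Finset I => Even S.card) _ (by simp)]
        rfl
      rw [h1, sub_eq_iff_eq_add', Finset.sum_filter_add_sum_filter_not]
      conv_lhs => rw [← b.sum_repr (x : CliffordAlgebra Q)]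
      simp [b]
    rw [hsum]
    refine Submodule.sum_mem _ fun S hS => Submodule.smul_mem _ _ ?_
    have := cliffordMonomial_mem_evenOdd Q e S.sort
    rwa [Finset.length_sort, (ZMod.natCast_eq_one_iff_odd).2
      (Nat.not_even_iff_odd.1 (Finset.mem_filter.1 hS).2)] at this
  have heven : (x : CliffordAlgebra Q) - y ∈ CliffordAlgebra.evenOdd Q 0 := (x - y).2
  have hzero : (x : CliffordAlgebra Q) - y = 0 := by
    have := (CliffordAlgebra.evenOdd_isCompl Q).disjoint
    exact (Submodule.disjoint_def.1 this) _ heven hodd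
  have hxy : x = y := Subtype.ext (sub_eq_zero.1 hzero)
  rw [hxy, hy]
  exact Submodule.sum_mem _ fun S _ => Submodule.smul_mem _ _ (Submodule.subset_span ⟨S, rfl⟩)

/-- The basis of the even Clifford algebra attached to an orthogonal basis. -/
def evenBasis (he : ∀ i j, i ≠ j → Q.IsOrtho (e i) (e j)) :
    Module.Basis {S : Finset I // Even S.card} K (CliffordAlgebra.even Q) :=
  Module.Basis.mk (linearIndependent_evenMonomial e he) (span_evenMonomial e he).ge

@[simp] lemma coe_evenBasis (he : ∀ i j, i ≠ j → Q.IsOrtho (e i) (e j))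
    (S : {S : Finset I // Even S.card}) :
    (evenBasis e he S : CliffordAlgebra Q) = cliffordMonomial Q e S.1.sort := by
  simp [evenBasis, evenMonomial]

/-- Multiplication by such a monomial sends the basis vector of `T` to a multiple of that of
`symmDiff (oddSupport l) T`, which differs from `T`. Hence the matrix has zero diagonal. -/
lemma trace_mulLeft_eq_zero (he : ∀ i j, i ≠ j → Q.IsOrtho (e i) (e j))
    {x : CliffordAlgebra.even Q} {c : K} {l : List I}
    (hx : (x : CliffordAlgebra Q) = c • cliffordMonomial Q e l) (hl : oddSupport l ≠ ∅) :
    LinearMap.trace K (CliffordAlgebra.even Q) (LinearMap.mulLeft K x) = 0 := by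
  rw [LinearMap.trace_eq_matrix_trace K (evenBasis e he), Matrix.trace]
  refine Finset.sum_eq_zero fun T _ => ?_
  rw [Matrix.diag_apply, LinearMap.toMatrix_apply, LinearMap.mulLeft_apply]
  obtain ⟨d, hd⟩ := exists_cliffordMonomial_eq he (l ++ T.1.sort)
  rw [oddSupport_append, oddSupport_sort] at hd
  set U := symmDiff (oddSupport l) T.1 with hU
  have hne : U ≠ T.1 := fun h => hl (by simpa using symmDiff_eq_right.1 h)
  have hmul : ((x * evenBasis e he T : CliffordAlgebra.even Q) : CliffordAlgebra Q) =
      (c * d) • cliffordMonomial Q e U.sort := by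
    rw [MulMemClass.coe_mul, hx, coe_evenBasis, smul_mul_assoc, ← cliffordMonomial_append, hd,
      smul_smul]
  by_cases hUe : Even U.card
  · have : x * evenBasis e he T = (c * d) • evenBasis e he ⟨U, hUe⟩ := by
      apply Subtype.ext
      rw [hmul, SetLike.val_smul, coe_evenBasis]
    rw [this, map_smul, Module.Basis.repr_self]
    simp [Subtype.ext_iff, hne]
  · have h1 : ((x * evenBasis e he T : CliffordAlgebra.even Q) : CliffordAlgebra Q) ∈
        CliffordAlgebra.evenOdd Q 1 := by
      rw [hmul]
      refine Submodule.smul_mem _ _ ?_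
      have := cliffordMonomial_mem_evenOdd Q e U.sort
      rwa [Finset.length_sort, (ZMod.natCast_eq_one_iff_odd).2 (Nat.not_even_iff_odd.1 hUe)]
        at this
    have h0 : x * evenBasis e he T = 0 := Subtype.ext <|
      (Submodule.disjoint_def.1 (CliffordAlgebra.evenOdd_isCompl Q).disjoint) _
        (x * evenBasis e he T).2 h1
    simp [h0]

end Basis

/-! ### Extending products, reversal and trace to real coefficients. -/

section RealExtension

variable {V : Type*} [AddCommGroup V] [Module ℚ V] {Q : LinearMap.BilinForm ℚ V}

lemma coe_vecMul (v w : V) : (vecMul Q v w : CliffordAlgebra (quadForm Q)) =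
    CliffordAlgebra.ι (quadForm Q) v * CliffordAlgebra.ι (quadForm Q) w := rfl

lemma vecMul_self (v : V) : vecMul Q v v = algebraMap ℚ (CPlus Q) (Q v v) :=
  (CliffordAlgebra.even.ι (quadForm Q)).contract v

lemma vecMul_mul_vecMul (u v w : V) : vecMul Q u v * vecMul Q v w = Q v v • vecMul Q u w :=
  (CliffordAlgebra.even.ι (quadForm Q)).contract_mid u v w

lemma vecMul_add_swap (hQ : ∀ v w, Q v w = Q w v) (v w : V) :
    vecMul Q v w + vecMul Q w v = algebraMap ℚ (CPlus Q) (2 * Q v w) := by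
  have h := vecMul_self (Q := Q) (v + w)
  simp only [map_add, LinearMap.add_apply, vecMul_self, hQ w v] at h
  rw [two_mul, map_add]
  linear_combination (norm := abel) h

/-- The polarized form of `vecMul_mul_vecMul`. It is linear in each of the four vectors, so it
passes to `V_ℝ` by induction on tensors, unlike the version quadratic in the middle vector. -/
lemma vecMul_mul_vecMul_add_swap (hQ : ∀ v w, Q v w = Q w v) (a b c d : V) :
    vecMul Q a b * vecMul Q c d + vecMul Q a c * vecMul Q b d =
      (2 * Q b c) • vecMul Q a d := by
  have h := vecMul_mul_vecMul (Q := Q) a (b + c) d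
  simp only [map_add, LinearMap.add_apply, hQ c b, add_mul, mul_add, vecMul_mul_vecMul,
    add_smul] at h
  rw [two_mul, add_smul]
  linear_combination (norm := abel) h

lemma coe_iota (x : CPlus Q) :
    (iota Q x : CliffordAlgebra (quadForm Q)) = CliffordAlgebra.reverse x.1 := rfl

lemma iota_one : iota Q 1 = 1 :=
  Subtype.ext <| by rw [coe_iota]; exact CliffordAlgebra.reverse.map_one

lemma iota_mul (x y : CPlus Q) : iota Q (x * y) = iota Q y * iota Q x :=
  Subtype.ext <| CliffordAlgebra.reverse.map_mul x.1 y.1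

lemma iota_iota (x : CPlus Q) : iota Q (iota Q x) = x :=
  Subtype.ext <| CliffordAlgebra.reverse_reverse x.1

lemma iota_vecMul (v w : V) : iota Q (vecMul Q v w) = vecMul Q w v :=
  Subtype.ext <| by simp [coe_iota, coe_vecMul]

lemma Tr_mul_comm (x y : CPlus Q) : Tr Q (x * y) = Tr Q (y * x) := by
  simp only [Tr, LinearMap.comp_apply, AlgHom.toLinearMap_apply, map_mul]
  exact LinearMap.trace_mul_comm ℚ _ _

/-- The real extension of the anti-involution `iota`. -/
def realIota (Q : LinearMap.BilinForm ℚ V) : RealExt (CPlus Q) →ₗ[ℝ] RealExt (CPlus Q) :=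
  (iota Q).baseChange ℝ

/-- The real extension of the trace `Tr`. -/
def realTr (Q : LinearMap.BilinForm ℚ V) : RealExt (CPlus Q) →ₗ[ℝ] ℝ :=
  (TensorProduct.AlgebraTensorModule.rid ℚ ℝ ℝ).toLinearMap ∘ₗ (Tr Q).baseChange ℝ

@[simp] lemma realIota_tmul (r : ℝ) (x : CPlus Q) :
    realIota Q (r ⊗ₜ x) = r ⊗ₜ iota Q x := rfl

@[simp] lemma realTr_tmul (r : ℝ) (x : CPlus Q) : realTr Q (r ⊗ₜ x) = Tr Q x • r := by
  simp [realTr]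

lemma realIota_one : realIota Q 1 = 1 := by
  rw [Algebra.TensorProduct.one_def, realIota_tmul, iota_one]

lemma realIota_mul (x y : RealExt (CPlus Q)) :
    realIota Q (x * y) = realIota Q y * realIota Q x := by
  induction x using TensorProduct.induction_on with
  | zero => simp
  | add x x' hx hx' => rw [add_mul, map_add, hx, hx', map_add, mul_add]
  | tmul r a =>
    induction y using TensorProduct.induction_on with
    | zero => simp
    | add y y' hy hy' => rw [mul_add, map_add, hy, hy', map_add, add_mul]
    | tmul s b => simp [iota_mul, mul_comm]

lemma realIota_realIota (x : RealExt (CPlus Q)) : realIota Q (realIota Q x) = x := by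
  induction x using TensorProduct.induction_on with
  | zero => simp
  | add x x' hx hx' => rw [map_add, map_add, hx, hx']
  | tmul r a => simp [iota_iota]

lemma realTr_mul_comm (x y : RealExt (CPlus Q)) : realTr Q (x * y) = realTr Q (y * x) := by
  induction x using TensorProduct.induction_on with
  | zero => simp
  | add x x' hx hx' => rw [add_mul, map_add, hx, hx', mul_add, map_add]
  | tmul r a =>
    induction y using TensorProduct.induction_on with
    | zero => simp
    | add y y' hy hy' => rw [mul_add, map_add, hy, hy', add_mul, map_add]
    | tmul s b => simp [Tr_mul_comm a b, mul_comm]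

lemma realTr_realIota (h : ∀ x, Tr Q (iota Q x) = Tr Q x) (x : RealExt (CPlus Q)) :
    realTr Q (realIota Q x) = realTr Q x := by
  induction x using TensorProduct.induction_on with
  | zero => simp
  | add x x' hx hx' => rw [map_add, map_add, hx, hx', map_add]
  | tmul r a => simp [h]

lemma formE_baseChange (α : CPlus Q) (v w : RealExt (CPlus Q)) :
    (formE Q α).baseChange ℝ v w = realTr Q ((1 : ℝ) ⊗ₜ α * realIota Q v * w) := by
  induction v using TensorProduct.induction_on with
  | zero => simp
  | add v v' hv hv' => rw [map_add, LinearMap.add_apply, hv, hv', map_add, mul_add, add_mul, map_add]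
  | tmul r a =>
    induction w using TensorProduct.induction_on with
    | zero => simp
    | add w w' hw hw' => rw [map_add, hw, hw', mul_add, map_add]
    | tmul s b => simp [formE]

@[simp] lemma realVecMul_tmul (r s : ℝ) (v w : V) :
    realVecMul Q (r ⊗ₜ v) (s ⊗ₜ w) = (r * s) ⊗ₜ vecMul Q v w :=
  LinearMap.BilinMap.baseChange_tmul _ _ _ _ _

lemma baseChange_symm (hQ : ∀ v w, Q v w = Q w v) (v w : RealExt V) :
    Q.baseChange ℝ v w = Q.baseChange ℝ w v := by
  induction v using TensorProduct.induction_on with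
  | zero => simp
  | add v v' hv hv' => rw [map_add, LinearMap.add_apply, hv, hv', map_add]
  | tmul r a =>
    induction w using TensorProduct.induction_on with
    | zero => simp
    | add w w' hw hw' => rw [map_add, hw, hw', map_add, LinearMap.add_apply]
    | tmul s b => simp [hQ a b, mul_comm]

lemma realVecMul_add_swap (hQ : ∀ v w, Q v w = Q w v) (v w : RealExt V) :
    realVecMul Q v w + realVecMul Q w v = (2 * Q.baseChange ℝ v w) • 1 := by
  induction v using TensorProduct.induction_on with
  | zero => simp
  | add v v' hv hv' =>
    simp only [map_add, LinearMap.add_apply, mul_add, add_smul, ← hv, ← hv']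
    abel
  | tmul r a =>
    induction w using TensorProduct.induction_on with
    | zero => simp
    | add w w' hw hw' =>
      simp only [map_add, LinearMap.add_apply, mul_add, add_smul, ← hw, ← hw']
      abel
    | tmul s b =>
      rw [realVecMul_tmul, realVecMul_tmul, mul_comm s r, ← TensorProduct.tmul_add,
        vecMul_add_swap hQ, Algebra.algebraMap_eq_smul_one, TensorProduct.tmul_smul,
        Algebra.TensorProduct.one_def, TensorProduct.smul_tmul', TensorProduct.smul_tmul']
      simp [Rat.smul_def]
      ring_nf

lemma realVecMul_mul_add_swap (hQ : ∀ v w, Q v w = Q w v) (a b c d : RealExt V) :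
    realVecMul Q a b * realVecMul Q c d + realVecMul Q a c * realVecMul Q b d =
      (2 * Q.baseChange ℝ b c) • realVecMul Q a d := by
  induction a using TensorProduct.induction_on with
  | zero => simp
  | add x y hx hy =>
    simp only [map_add, LinearMap.add_apply, add_mul, smul_add, ← hx, ← hy]
    abel
  | tmul r a =>
  induction d using TensorProduct.induction_on with
  | zero => simp
  | add x y hx hy =>
    simp only [map_add, mul_add, smul_add, ← hx, ← hy]
    abel
  | tmul s d =>
  induction b using TensorProduct.induction_on with
  | zero => simp
  | add x y hx hy =>
    simp only [map_add, LinearMap.add_apply, mul_add, add_mul, add_smul, ← hx, ← hy]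
    abel
  | tmul t b =>
  induction c using TensorProduct.induction_on with
  | zero => simp
  | add x y hx hy =>
    simp only [map_add, LinearMap.add_apply, mul_add, add_mul, add_smul, ← hx, ← hy]
    abel
  | tmul u c =>
    have h := vecMul_mul_vecMul_add_swap hQ a b c d
    simp only [realVecMul_tmul, Algebra.TensorProduct.tmul_mul_tmul]
    rw [show r * u * (t * s) = r * t * (u * s) by ring, ← TensorProduct.tmul_add, h,
      TensorProduct.tmul_smul, TensorProduct.smul_tmul', TensorProduct.smul_tmul']
    simp [Rat.smul_def]
    ring_nf

lemma realIota_realVecMul (v w : RealExt V) :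
    realIota Q (realVecMul Q v w) = realVecMul Q w v := by
  induction v using TensorProduct.induction_on with
  | zero => simp
  | add v v' hv hv' => simp [hv, hv']
  | tmul r a =>
    induction w using TensorProduct.induction_on with
    | zero => simp
    | add w w' hw hw' => simp [hw, hw']
    | tmul s b => simp [iota_vecMul, mul_comm]

end RealExtension

/-! ### Positivity and reversal invariance of the trace. -/

section Trace

variable {V : Type*} [AddCommGroup V] [Module ℚ V] {Q : LinearMap.BilinForm ℚ V}

lemma isOrtho_quadForm (hQ : ∀ v w, Q v w = Q w v) {v w : V} (h : Q v w = 0) :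
    (quadForm Q).IsOrtho v w := by
  simp [QuadraticMap.isOrtho_def, hQ w v, h]

variable {I : Type*} [LinearOrder I] [Fintype I] (e : Module.Basis I ℚ V)

lemma Tr_eq_zero (he : ∀ i j, i ≠ j → (quadForm Q).IsOrtho (e i) (e j))
    {x : CPlus Q} {l : List I} (hx : x.1 = cliffordMonomial (quadForm Q) e l)
    (hl : oddSupport l ≠ ∅) : Tr Q x = 0 :=
  trace_mulLeft_eq_zero e he (c := 1) (by rw [hx, one_smul]) hl

lemma Tr_one_pos (he : ∀ i j, i ≠ j → (quadForm Q).IsOrtho (e i) (e j)) :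
    0 < Tr Q 1 := by
  have hT : Tr Q 1 = Module.finrank ℚ (CPlus Q) := by
    simp only [Tr, LinearMap.comp_apply, AlgHom.toLinearMap_apply, map_one]
    have := Module.Finite.of_basis (evenBasis e he)
    exact LinearMap.trace_one ℚ (CPlus Q)
  rw [hT, Module.finrank_eq_card_basis (evenBasis e he), Nat.cast_pos, Fintype.card_pos_iff]
  exact ⟨⟨∅, by simp⟩⟩

/-- Reversing a word keeps its odd support, so on every basis monomial other than `1` both traces
vanish. -/
lemma Tr_iota (he : ∀ i j, i ≠ j → (quadForm Q).IsOrtho (e i) (e j)) (x : CPlus Q) :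
    Tr Q (iota Q x) = Tr Q x := by
  suffices Tr Q ∘ₗ iota Q = Tr Q from LinearMap.congr_fun this x
  refine (evenBasis e he).ext fun S => ?_
  rw [LinearMap.comp_apply]
  by_cases hS : S.1 = ∅
  · have : evenBasis e he S = 1 := Subtype.ext <| by simp [hS]
    rw [this, iota_one]
  · rw [Tr_eq_zero e he (coe_evenBasis e he S) (by rwa [oddSupport_sort])]
    refine Tr_eq_zero e he (l := S.1.sort.reverse) ?_ (by rwa [oddSupport_reverse, oddSupport_sort])
    rw [coe_iota, coe_evenBasis, reverse_cliffordMonomial]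

end Trace

/-! ### Conjugating `e₁e₂` by monomials. -/

section Diagonal

variable {V : Type*} [AddCommGroup V] [Module ℚ V] {Q : LinearMap.BilinForm ℚ V}
  {I : Type*} {e : I → V}

lemma vecMul_mul_self_of_isOrtho (he : ∀ i j, i ≠ j → (quadForm Q).IsOrtho (e i) (e j))
    {i₀ i₁ : I} (h01 : i₀ ≠ i₁) :
    vecMul Q (e i₀) (e i₁) * vecMul Q (e i₀) (e i₁) =
      (-(Q (e i₀) (e i₀) * Q (e i₁) (e i₁))) • 1 := by
  have hanti : vecMul Q (e i₀) (e i₁) = - vecMul Q (e i₁) (e i₀) :=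
    Subtype.ext (CliffordAlgebra.ι_mul_ι_comm_of_isOrtho (he i₀ i₁ h01))
  conv_lhs => enter [2]; rw [hanti]
  rw [mul_neg, vecMul_mul_vecMul, vecMul_self, Algebra.algebraMap_eq_smul_one, smul_smul,
    ← neg_smul, mul_comm]

variable [DecidableEq I]

/-- `e i` anticommutes with the product when `i` is one of its two indices and commutes with it
otherwise. -/
lemma ι_mul_mul_ι_of_isOrtho (he : ∀ i j, i ≠ j → (quadForm Q).IsOrtho (e i) (e j))
    {i₀ i₁ : I} (h01 : i₀ ≠ i₁) (i : I) :
    CliffordAlgebra.ι (quadForm Q) (e i) * ((vecMul Q (e i₀) (e i₁)).1 *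
      CliffordAlgebra.ι (quadForm Q) (e i)) =
    (if i = i₀ ∨ i = i₁ then -Q (e i) (e i) else Q (e i) (e i)) • (vecMul Q (e i₀) (e i₁)).1 := by
  rw [coe_vecMul]
  have hsq : ∀ j, CliffordAlgebra.ι (quadForm Q) (e j) * CliffordAlgebra.ι (quadForm Q) (e j) =
      Q (e j) (e j) • 1 := fun j => by
    rw [CliffordAlgebra.ι_sq_scalar, Algebra.algebraMap_eq_smul_one]; rfl
  have hanti : ∀ j k, j ≠ k →
      CliffordAlgebra.ι (quadForm Q) (e j) * CliffordAlgebra.ι (quadForm Q) (e k) =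
      -(CliffordAlgebra.ι (quadForm Q) (e k) * CliffordAlgebra.ι (quadForm Q) (e j)) :=
    fun j k hjk => CliffordAlgebra.ι_mul_ι_comm_of_isOrtho (he j k hjk)
  set x := fun j => CliffordAlgebra.ι (quadForm Q) (e j) with hx
  change x i * (x i₀ * x i₁ * x i) = _ • (x i₀ * x i₁)
  replace hsq : ∀ j, x j * x j = Q (e j) (e j) • 1 := hsq
  replace hanti : ∀ j k, j ≠ k → x j * x k = -(x k * x j) := hanti
  by_cases hi0 : i = i₀
  · subst hi0
    rw [if_pos (Or.inl rfl), mul_assoc, ← mul_assoc, hsq, hanti i₁ i h01.symm]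
    simp
  · by_cases hi1 : i = i₁
    · subst hi1
      rw [if_pos (Or.inr rfl), mul_assoc, hsq, ← mul_assoc, hanti i i₀ hi0]
      simp
    · rw [if_neg (by tauto), ← mul_assoc, ← mul_assoc, hanti i i₀ hi0, neg_mul, neg_mul,
        mul_assoc (x i₀), hanti i i₁ hi1, mul_neg, neg_mul, neg_neg, mul_assoc, mul_assoc, hsq]
      simp

/-- Each letter contributes `-Q (e i) (e i)` for the two negative directions and `Q (e i) (e i)` for
the others. The signature makes every factor positive. -/
lemma exists_pos_reverse_mul_vecMul_mul
    (he : ∀ i j, i ≠ j → (quadForm Q).IsOrtho (e i) (e j))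
    {i₀ i₁ : I} (h01 : i₀ ≠ i₁) (h0 : Q (e i₀) (e i₀) < 0) (h1 : Q (e i₁) (e i₁) < 0)
    (hpos : ∀ i, i ≠ i₀ → i ≠ i₁ → 0 < Q (e i) (e i)) (l : List I) :
    ∃ k : ℚ, 0 < k ∧ CliffordAlgebra.reverse (cliffordMonomial (quadForm Q) e l) *
      ((vecMul Q (e i₀) (e i₁)).1 * cliffordMonomial (quadForm Q) e l) =
      k • (vecMul Q (e i₀) (e i₁)).1 := by
  induction l with
  | nil => exact ⟨1, one_pos, by simp⟩
  | cons i l ih =>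
    obtain ⟨k, hk, h⟩ := ih
    refine ⟨(if i = i₀ ∨ i = i₁ then -Q (e i) (e i) else Q (e i) (e i)) * k, ?_, ?_⟩
    · refine mul_pos ?_ hk
      split_ifs with hi
      · rcases hi with rfl | rfl <;> linarith
      · exact hpos i (by tauto) (by tauto)
    · rw [cliffordMonomial_cons, CliffordAlgebra.reverse.map_mul, CliffordAlgebra.reverse_ι]
      have h2 := ι_mul_mul_ι_of_isOrtho he h01 i
      rw [mul_smul, ← h, ← mul_smul_comm, ← smul_mul_assoc, ← h2]
      simp only [mul_assoc]

end Diagonal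

lemma bilinForm_self_pos_of_basis {M ι : Type*} [AddCommGroup M] [Module ℝ M] [Fintype ι]
    (b : Module.Basis ι ℝ M) (F : LinearMap.BilinForm ℝ M)
    (hoff : ∀ i j, i ≠ j → F (b i) (b j) = 0) (hdiag : ∀ i, 0 < F (b i) (b i))
    {v : M} (hv : v ≠ 0) : 0 < F v v := by
  have hsum : F v v = ∑ i, b.repr v i ^ 2 * F (b i) (b i) := by
    conv_lhs => rw [← b.sum_repr v]
    simp only [map_sum, LinearMap.sum_apply, map_smul, LinearMap.smul_apply, smul_eq_mul]
    refine Finset.sum_congr rfl fun i _ => ?_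
    rw [Finset.sum_eq_single i]
    · ring
    · intro j _ hj
      simp [hoff j i hj]
    · simp
  rw [hsum]
  obtain ⟨i, hi⟩ : ∃ i, b.repr v i ≠ 0 := by
    by_contra! h
    exact hv (b.ext_elem fun i => by simp [h i])
  exact Finset.sum_pos' (fun j _ => mul_nonneg (sq_nonneg _) (hdiag j).le)
    ⟨i, Finset.mem_univ i, mul_pos (by positivity) (hdiag i)⟩

/-! ### Definiteness of the trace form, and its transfer between negative planes. -/

section Definite

variable {V : Type*} [AddCommGroup V] [Module ℚ V] {Q : LinearMap.BilinForm ℚ V}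

/-- The form `(v, w) ↦ Tr(α ι(v) J w)` on `C⁺(Q)_ℝ` is negative definite. -/
def TraceNegDef (α : CPlus Q) (J : RealExt (CPlus Q)) : Prop :=
  ∀ v : RealExt (CPlus Q), v ≠ 0 → realTr Q ((1 : ℝ) ⊗ₜ α * realIota Q v * (J * v)) < 0

lemma traceNegDef_smul {α : CPlus Q} {J : RealExt (CPlus Q)} {r : ℝ} (hr : 0 < r)
    (h : TraceNegDef α J) : TraceNegDef α (r • J) := by
  intro v hv
  rw [smul_mul_assoc, mul_smul_comm, map_smul, smul_eq_mul]
  exact mul_neg_of_pos_of_neg hr (h v hv)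

/-- Off the diagonal the two copies of `e₁e₂` cancel in the odd support, leaving the nonempty
`symmDiff S T`. On the diagonal the product is a positive multiple of `α * α`, a negative scalar. -/
lemma traceNegDef_vecMul {I : Type*} [LinearOrder I] [Fintype I] (e : Module.Basis I ℚ V)
    (he : ∀ i j, i ≠ j → (quadForm Q).IsOrtho (e i) (e j))
    {i₀ i₁ : I} (h01 : i₀ ≠ i₁) (h0 : Q (e i₀) (e i₀) < 0) (h1 : Q (e i₁) (e i₁) < 0)
    (hpos : ∀ i, i ≠ i₀ → i ≠ i₁ → 0 < Q (e i) (e i)) :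
    TraceNegDef (vecMul Q (e i₀) (e i₁)) ((1 : ℝ) ⊗ₜ vecMul Q (e i₀) (e i₁)) := by
  intro v hv
  set α := vecMul Q (e i₀) (e i₁) with hα
  set F : LinearMap.BilinForm ℝ (RealExt (CPlus Q)) :=
    -((formE Q α).baseChange ℝ).compl₂ (LinearMap.mulLeft ℝ ((1 : ℝ) ⊗ₜ α)) with hF
  have hFv : ∀ v w, F v w =
      -realTr Q ((1 : ℝ) ⊗ₜ α * realIota Q v * ((1 : ℝ) ⊗ₜ α * w)) := fun v w => by
    simp only [hF, LinearMap.neg_apply, LinearMap.compl₂_apply, formE_baseChange,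
      LinearMap.mulLeft_apply]
  have hFb : ∀ x y : CPlus Q, F ((1 : ℝ) ⊗ₜ x) ((1 : ℝ) ⊗ₜ y) =
      ((-Tr Q (α * iota Q x * (α * y)) : ℚ) : ℝ) := fun x y => by
    simp [hFv, Rat.smul_def]
  suffices 0 < F v v by rw [hFv] at this; linarith
  refine bilinForm_self_pos_of_basis ((evenBasis e he).baseChange ℝ) F ?_ ?_ hv
  · intro S T hST
    rw [Module.Basis.baseChange_apply, Module.Basis.baseChange_apply, hFb, Rat.cast_eq_zero,
      neg_eq_zero]
    refine Tr_eq_zero e he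
      (l := [i₀, i₁] ++ S.1.sort.reverse ++ ([i₀, i₁] ++ T.1.sort)) ?_ ?_
    · simp only [cliffordMonomial_append, MulMemClass.coe_mul, coe_iota, coe_evenBasis,
        reverse_cliffordMonomial, hα, coe_vecMul]
      simp
    · simp only [oddSupport_append, oddSupport_reverse, oddSupport_sort]
      rw [symmDiff_symmDiff_symmDiff_comm, symmDiff_self, bot_symmDiff]
      exact fun h => hST (Subtype.ext (symmDiff_eq_bot.1 h))
  · intro S
    rw [Module.Basis.baseChange_apply, hFb, Rat.cast_pos]
    obtain ⟨k, hk, h⟩ := exists_pos_reverse_mul_vecMul_mul he h01 h0 h1 hpos S.1.sort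
    have hmul : α * iota Q (evenBasis e he S) * (α * evenBasis e he S) =
        (-(k * (Q (e i₀) (e i₀) * Q (e i₁) (e i₁)))) • 1 := by
      have h' : iota Q (evenBasis e he S) * (α * evenBasis e he S) = k • α := by
        apply Subtype.ext
        rw [MulMemClass.coe_mul, MulMemClass.coe_mul, coe_iota, coe_evenBasis, hα, h]
        rfl
      rw [mul_assoc, h', mul_smul_comm, hα, vecMul_mul_self_of_isOrtho he h01, smul_smul,
        mul_neg]
    rw [hmul, map_smul, smul_eq_mul]
    have := mul_pos (mul_pos hk (mul_pos_of_neg_of_neg h0 h1)) (Tr_one_pos e he)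
    linarith

lemma realVecMul_self (hQ : ∀ v w, Q v w = Q w v) (v : RealExt V) :
    realVecMul Q v v = Q.baseChange ℝ v v • 1 := by
  have h := realVecMul_add_swap hQ v v
  rw [← two_smul ℝ, mul_smul] at h
  exact smul_right_injective _ (two_ne_zero' ℝ) h

lemma realVecMul_swap (hQ : ∀ v w, Q v w = Q w v) {v w : RealExt V}
    (h : Q.baseChange ℝ v w = 0) : realVecMul Q w v = -realVecMul Q v w := by
  have h' := realVecMul_add_swap hQ v w
  rw [h, mul_zero, zero_smul] at h'
  exact eq_neg_of_add_eq_zero_right h'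

lemma realVecMul_mul_of_orthogonal (hQ : ∀ v w, Q v w = Q w v) {p q f : RealExt V}
    (hf : Q.baseChange ℝ f f = -1) (hqf : Q.baseChange ℝ q f = 0) :
    realVecMul Q p f * realVecMul Q q f = realVecMul Q p q := by
  have h := realVecMul_mul_add_swap hQ p f q f
  rw [baseChange_symm hQ f q, hqf, mul_zero, zero_smul, realVecMul_self hQ f, hf,
    mul_smul_comm, mul_one, neg_one_smul] at h
  exact add_neg_eq_zero.1 h

lemma realVecMul_mul_self (hQ : ∀ v w, Q v w = Q w v) {p f : RealExt V}
    (hp : Q.baseChange ℝ p p = -1) (hf : Q.baseChange ℝ f f = -1)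
    (hpf : Q.baseChange ℝ p f = 0) :
    realVecMul Q p f * realVecMul Q p f = -1 := by
  rw [realVecMul_mul_of_orthogonal hQ hf hpf, realVecMul_self hQ, hp, neg_one_smul]

/-- The element `g = 1 - J * J'` intertwines `J` and `J'`, and `k = ι(g)` satisfies `g * k = r` with
`r > 0`. So the form of `J'` at `k * v` is `r` times the form of `J` at `v`. -/
lemma TraceNegDef.of_nonpos {α : CPlus Q} (hQ : ∀ v w, Q v w = Q w v) {p q f : RealExt V}
    (hp : Q.baseChange ℝ p p = -1) (hq : Q.baseChange ℝ q q = -1)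
    (hf : Q.baseChange ℝ f f = -1) (hpf : Q.baseChange ℝ p f = 0)
    (hqf : Q.baseChange ℝ q f = 0) (hpq : Q.baseChange ℝ p q ≤ 0)
    (h : TraceNegDef α (realVecMul Q q f)) : TraceNegDef α (realVecMul Q p f) := by
  intro v hv
  set J := realVecMul Q p f with hJ
  set J' := realVecMul Q q f with hJ'
  set r : ℝ := 2 - 2 * Q.baseChange ℝ p q with hr
  have hrpos : 0 < r := by linarith
  have hJJ : J * J = -1 := realVecMul_mul_self hQ hp hf hpf
  have hJJ' : J' * J' = -1 := realVecMul_mul_self hQ hq hf hqf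
  have hsum : J * J' + J' * J = (2 * Q.baseChange ℝ p q) • 1 := by
    rw [hJ, hJ', realVecMul_mul_of_orthogonal hQ hf hqf, realVecMul_mul_of_orthogonal hQ hf hpf,
      realVecMul_add_swap hQ]
  have hιJ : realIota Q J = -J := by
    rw [hJ, realIota_realVecMul, realVecMul_swap hQ hpf]
  have hιJ' : realIota Q J' = -J' := by
    rw [hJ', realIota_realVecMul, realVecMul_swap hQ hqf]
  set g := 1 - J * J' with hg
  set k := 1 - J' * J with hk
  have hιk : realIota Q k = g := by
    rw [hk, map_sub, realIota_one, realIota_mul, hιJ, hιJ', neg_mul_neg]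
  have hgk : g * k = r • 1 := by
    have h4 : J * J' * (J' * J) = 1 := by
      rw [mul_assoc, ← mul_assoc J' J', hJJ', neg_one_mul, mul_neg, hJJ, neg_neg]
    have : g * k = 2 • 1 - (J * J' + J' * J) := by
      rw [hg, hk, sub_mul, one_mul, mul_sub, mul_one, h4]
      abel
    rw [this, hsum, hr, sub_smul]
    norm_num [two_smul, ofNat_smul_eq_nsmul]
  have hJg : J * g = g * J' := by
    rw [hg, mul_sub, sub_mul, mul_one, one_mul, ← mul_assoc, hJJ, mul_assoc, hJJ']
    simp [add_comm]
  have hw : k * v ≠ 0 := by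
    intro h0
    have : r • v = 0 := by
      rw [← one_mul v, ← smul_mul_assoc, ← hgk, mul_assoc, h0, mul_zero]
    exact hv ((smul_eq_zero.1 this).resolve_left hrpos.ne')
  have key := h _ hw
  have heq : (1 : ℝ) ⊗ₜ α * realIota Q (k * v) * (J' * (k * v)) =
      r • ((1 : ℝ) ⊗ₜ α * realIota Q v * (J * v)) := by
    have h5 : g * (J' * (k * v)) = r • (J * v) := by
      rw [← mul_assoc, ← hJg, mul_assoc, ← mul_assoc g, hgk, smul_mul_assoc, one_mul,
        mul_smul_comm]
    rw [realIota_mul, hιk, mul_assoc, mul_assoc (realIota Q v), h5, mul_smul_comm, mul_smul_comm,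
      mul_assoc]
  rw [heq, map_smul, smul_eq_mul] at key
  exact neg_of_mul_neg_right key hrpos.le

/-- The form `(v, w) ↦ Tr(α ι(v) J w)` on `C⁺(Q)_ℝ` is definite. -/
def TraceDefinite (α : CPlus Q) (J : RealExt (CPlus Q)) : Prop :=
  TraceNegDef α J ∨ TraceNegDef α (-J)

lemma TraceDefinite.neg {α : CPlus Q} {J : RealExt (CPlus Q)} (h : TraceDefinite α J) :
    TraceDefinite α (-J) := by
  rcases h with h | h
  · exact Or.inr (by rwa [neg_neg])
  · exact Or.inl h

/-- Signs of `p` and `q` are chosen to make `Q(p,q) ≤ 0`. Each change of sign negates the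
corresponding product, which definiteness up to sign tolerates. -/
lemma TraceDefinite.of_orthogonal {α : CPlus Q} (hQ : ∀ v w, Q v w = Q w v)
    {p q f : RealExt V}
    (hp : Q.baseChange ℝ p p = -1) (hq : Q.baseChange ℝ q q = -1)
    (hf : Q.baseChange ℝ f f = -1) (hpf : Q.baseChange ℝ p f = 0)
    (hqf : Q.baseChange ℝ q f = 0)
    (h : TraceDefinite α (realVecMul Q q f)) : TraceDefinite α (realVecMul Q p f) := by
  rcases le_total (Q.baseChange ℝ p q) 0 with hpq | hpq
  · rcases h with h | h
    · exact Or.inl (h.of_nonpos hQ hp hq hf hpf hqf hpq)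
    · refine Or.inr ?_
      have h' : TraceNegDef α (realVecMul Q (-q) f) := by simpa using h
      have := h'.of_nonpos hQ (p := -p) (by simpa using hp) (by simpa using hq) hf
        (by simpa using hpf) (by simpa using hqf) (by simpa using hpq)
      simpa using this
  · rcases h with h | h
    · refine Or.inr ?_
      have := h.of_nonpos hQ (p := -p) (by simpa using hp) hq hf
        (by simpa using hpf) hqf (by simpa using hpq)
      simpa using this
    · have h' : TraceNegDef α (realVecMul Q (-q) f) := by simpa using h
      exact Or.inl (h'.of_nonpos hQ hp (by simpa using hq) hf hpf (by simpa using hqf)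
        (by simpa using hpq))

/-- The plane of `p, q` contains a unit vector `u` orthogonal to `f₂`. The planes `⟨p, q⟩ = ⟨w, u⟩`,
`⟨u, f₂⟩`, `⟨f₁, f₂⟩` form a chain in which neighbours share a vector. -/
lemma TraceDefinite.of_orthonormal {α : CPlus Q} (hQ : ∀ v w, Q v w = Q w v)
    {p q f₁ f₂ : RealExt V}
    (hp : Q.baseChange ℝ p p = -1) (hq : Q.baseChange ℝ q q = -1)
    (hpq : Q.baseChange ℝ p q = 0) (h₁ : Q.baseChange ℝ f₁ f₁ = -1)
    (h₂ : Q.baseChange ℝ f₂ f₂ = -1) (h₁₂ : Q.baseChange ℝ f₁ f₂ = 0)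
    (h : TraceDefinite α (realVecMul Q p q)) : TraceDefinite α (realVecMul Q f₁ f₂) := by
  have hqp : Q.baseChange ℝ q p = 0 := by rw [baseChange_symm hQ, hpq]
  obtain ⟨c, s, hcs, horth⟩ : ∃ c s : ℝ, c ^ 2 + s ^ 2 = 1 ∧
      c * Q.baseChange ℝ p f₂ + s * Q.baseChange ℝ q f₂ = 0 := by
    set a := Q.baseChange ℝ p f₂
    set b := Q.baseChange ℝ q f₂
    by_cases hab : a ^ 2 + b ^ 2 = 0
    · have ha : a = 0 := by nlinarith [sq_nonneg a, sq_nonneg b]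
      have hb : b = 0 := by nlinarith [sq_nonneg a, sq_nonneg b]
      exact ⟨1, 0, by norm_num, by simp [ha]⟩
    · have hpos : 0 < a ^ 2 + b ^ 2 := lt_of_le_of_ne (by positivity) (Ne.symm hab)
      have hsq := Real.sq_sqrt hpos.le
      have hne := (Real.sqrt_pos.2 hpos).ne'
      -- The vector `(b, -a)`, orthogonal to `(a, b)`, normalized.
      refine ⟨b / √(a ^ 2 + b ^ 2), -a / √(a ^ 2 + b ^ 2), ?_, ?_⟩
      · field_simp
        rw [hsq]
        ring
      · field_simp
        ring
  set u := c • p + s • q with hu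
  set w := (-s) • p + c • q with hw
  have huu : Q.baseChange ℝ u u = -1 := by
    simp only [hu, map_add, map_smul, LinearMap.add_apply, LinearMap.smul_apply, smul_eq_mul,
      hp, hq, hpq, hqp]
    linear_combination -hcs
  have hww : Q.baseChange ℝ w w = -1 := by
    simp only [hw, map_add, map_smul, LinearMap.add_apply, LinearMap.smul_apply, smul_eq_mul,
      hp, hq, hpq, hqp]
    linear_combination -hcs
  have hwu : Q.baseChange ℝ w u = 0 := by
    simp only [hu, hw, map_add, map_smul, LinearMap.add_apply, LinearMap.smul_apply, smul_eq_mul,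
      hp, hq, hpq, hqp]
    ring
  have huf : Q.baseChange ℝ u f₂ = 0 := by
    simpa only [hu, map_add, map_smul, LinearMap.add_apply, LinearMap.smul_apply, smul_eq_mul]
      using horth
  have hfu : Q.baseChange ℝ f₂ u = 0 := by rw [baseChange_symm hQ, huf]
  -- The pair `(w, u)` is an orthonormal basis of the same plane with the opposite orientation,
  -- hence the sign.
  have hmul : realVecMul Q w u = -realVecMul Q p q := by
    simp only [hu, hw, map_add, map_smul, LinearMap.add_apply, LinearMap.smul_apply,
      realVecMul_self hQ, hp, hq, realVecMul_swap hQ hpq]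
    have : realVecMul Q p q = (c ^ 2 + s ^ 2) • realVecMul Q p q := by rw [hcs, one_smul]
    conv_rhs => rw [this]
    module
  have h1 : TraceDefinite α (realVecMul Q w u) := by rw [hmul]; exact h.neg
  have h2 := h1.of_orthogonal hQ h₂ hww huu hfu hwu
  have h3 : TraceDefinite α (realVecMul Q u f₂) := by
    rw [realVecMul_swap hQ hfu]; exact h2.neg
  exact h3.of_orthogonal hQ h₁ huu h₂ h₁₂ huf

end Definite

/-! ### Real and imaginary parts in a complexification. -/

section Complexification

variable {W : Type*} [AddCommGroup W] [Module ℝ W]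

/-- The real part of a vector of a complexification. -/
def cplxRe (W : Type*) [AddCommGroup W] [Module ℝ W] : ℂ ⊗[ℝ] W →ₗ[ℝ] W :=
  (TensorProduct.lid ℝ W).toLinearMap ∘ₗ Complex.reLm.rTensor W

/-- The imaginary part of a vector of a complexification. -/
def cplxIm (W : Type*) [AddCommGroup W] [Module ℝ W] : ℂ ⊗[ℝ] W →ₗ[ℝ] W :=
  (TensorProduct.lid ℝ W).toLinearMap ∘ₗ Complex.imLm.rTensor W

@[simp] lemma cplxRe_tmul (z : ℂ) (w : W) : cplxRe W (z ⊗ₜ w) = z.re • w := by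
  simp [cplxRe]

@[simp] lemma cplxIm_tmul (z : ℂ) (w : W) : cplxIm W (z ⊗ₜ w) = z.im • w := by
  simp [cplxIm]

lemma one_tmul_cplxRe_add (x : ℂ ⊗[ℝ] W) :
    (1 : ℂ) ⊗ₜ[ℝ] cplxRe W x + Complex.I ⊗ₜ[ℝ] cplxIm W x = x := by
  induction x using TensorProduct.induction_on with
  | zero => simp
  | add x y hx hy =>
    conv_rhs => rw [← hx, ← hy]
    simp only [map_add, TensorProduct.tmul_add]
    abel
  | tmul z w =>
    rw [cplxRe_tmul, cplxIm_tmul, ← TensorProduct.smul_tmul, ← TensorProduct.smul_tmul,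
      ← TensorProduct.add_tmul]
    congr 1
    apply Complex.ext <;> simp

lemma one_tmul_add_I_tmul_inj {a b c d : W}
    (h : (1 : ℂ) ⊗ₜ[ℝ] a + Complex.I ⊗ₜ[ℝ] b = (1 : ℂ) ⊗ₜ[ℝ] c + Complex.I ⊗ₜ[ℝ] d) :
    a = c ∧ b = d :=
  ⟨by simpa using congrArg (cplxRe W) h, by simpa using congrArg (cplxIm W) h⟩

lemma smul_one_tmul_add_I_tmul (z : ℂ) (a b : W) :
    z • ((1 : ℂ) ⊗ₜ[ℝ] a + Complex.I ⊗ₜ[ℝ] b) =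
      (1 : ℂ) ⊗ₜ[ℝ] (z.re • a - z.im • b) + Complex.I ⊗ₜ[ℝ] (z.im • a + z.re • b) := by
  conv_lhs => rw [← one_tmul_cplxRe_add (z • ((1 : ℂ) ⊗ₜ[ℝ] a + Complex.I ⊗ₜ[ℝ] b))]
  simp [smul_add, TensorProduct.smul_tmul', sub_eq_add_neg]

end Complexification

/-! ### Adapted pairs in weight two, and weight one structures from a complex structure. -/

section HodgeComponent

variable {V : Type*} [AddCommGroup V] [Module ℚ V]

lemma mem_hodgeComponent {h : ℂˣ → Module.End ℝ (RealExt V)} {p q : ℕ} {x : CplxExt V} :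
    x ∈ hodgeComponent h p q ↔
      ∀ z : ℂˣ, (h z).baseChange ℂ x = ((z : ℂ) ^ p * (starRingEnd ℂ (z : ℂ)) ^ q) • x := by
  simp [hodgeComponent, Submodule.mem_iInf]

lemma apply_of_mem_hodgeComponent_two_zero {h : ℂˣ → Module.End ℝ (RealExt V)}
    {f₁ f₂ : RealExt V}
    (hf : (1 : ℂ) ⊗ₜ[ℝ] f₁ + Complex.I ⊗ₜ[ℝ] f₂ ∈ hodgeComponent h 2 0) (z : ℂˣ) :
    h z f₁ = ((z : ℂ) ^ 2).re • f₁ - ((z : ℂ) ^ 2).im • f₂ ∧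
    h z f₂ = ((z : ℂ) ^ 2).im • f₁ + ((z : ℂ) ^ 2).re • f₂ := by
  have := mem_hodgeComponent.1 hf z
  rw [pow_zero, mul_one, smul_one_tmul_add_I_tmul, map_add, LinearMap.baseChange_tmul,
    LinearMap.baseChange_tmul] at this
  exact one_tmul_add_I_tmul_inj this

lemma unitI_apply_of_mem_hodgeComponent_two_zero {h : ℂˣ → Module.End ℝ (RealExt V)}
    {f₁ f₂ : RealExt V}
    (hf : (1 : ℂ) ⊗ₜ[ℝ] f₁ + Complex.I ⊗ₜ[ℝ] f₂ ∈ hodgeComponent h 2 0) :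
    h unitI f₁ = -f₁ ∧ h unitI f₂ = -f₂ := by
  have := apply_of_mem_hodgeComponent_two_zero hf unitI
  simpa [unitI] using this

lemma baseChange_of_mem_hodgeComponent_two_zero {h : ℂˣ → Module.End ℝ (RealExt V)}
    {Q : LinearMap.BilinForm ℚ V} (hQ : IsPolarization 2 h Q) (hs : ∀ v w, Q v w = Q w v)
    {f₁ f₂ : RealExt V}
    (hf : (1 : ℂ) ⊗ₜ[ℝ] f₁ + Complex.I ⊗ₜ[ℝ] f₂ ∈ hodgeComponent h 2 0) :
    Q.baseChange ℝ f₂ f₂ = Q.baseChange ℝ f₁ f₁ ∧ Q.baseChange ℝ f₁ f₂ = 0 := by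
  -- At `z = 1 + i` one has `z² = 2i`, so `h z` sends `f₁` to `-2f₂` and `f₂` to `2f₁`, while `Q` is
  -- scaled by `4`. Comparing gives both identities.
  have hz : (1 + Complex.I : ℂ) ≠ 0 := fun h => by simpa using congrArg Complex.re h
  obtain ⟨h1, h2⟩ := apply_of_mem_hodgeComponent_two_zero hf (Units.mk0 _ hz)
  have hre : ((1 + Complex.I : ℂ) ^ 2).re = 0 := by simp [pow_two]
  have him : ((1 + Complex.I : ℂ) ^ 2).im = 2 := by simp [pow_two]; norm_num
  have hn : Complex.normSq (1 + Complex.I) = 2 := by simp [Complex.normSq_apply]; norm_num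
  rw [Units.val_mk0, hre, him, zero_smul] at h1 h2
  have e1 := hQ.equivariant (Units.mk0 _ hz) f₁ f₁
  have e2 := hQ.equivariant (Units.mk0 _ hz) f₁ f₂
  rw [h1, Units.val_mk0, hn] at e1
  rw [h1, h2, Units.val_mk0, hn] at e2
  simp only [zero_sub, add_zero, map_neg, map_smul, LinearMap.neg_apply, LinearMap.smul_apply,
    smul_eq_mul, baseChange_symm hs f₂ f₁] at e1 e2
  constructor <;> linarith

/-- `h(i)` acts as `-1` on the real and imaginary parts of a generator, so positivity of the
polarization makes `Q` negative on them, and a real rescaling gives norm `-1`. -/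
lemma exists_isAdapted {h : ℂˣ → Module.End ℝ (RealExt V)}
    {Q : LinearMap.BilinForm ℚ V} (hQ : IsPolarization 2 h Q) (hs : ∀ v w, Q v w = Q w v)
    (hdim : Module.finrank ℂ (hodgeComponent h 2 0) = 1) :
    ∃ f₁ f₂ : RealExt V, IsAdapted h Q f₁ f₂ := by
  obtain ⟨⟨ω, hω⟩, hω0, hspan⟩ := finrank_eq_one_iff'.1 hdim
  replace hω0 : ω ≠ 0 := fun h0 => hω0 (Subtype.ext h0)
  obtain ⟨g₁, g₂, rfl⟩ : ∃ g₁ g₂, (1 : ℂ) ⊗ₜ[ℝ] g₁ + Complex.I ⊗ₜ[ℝ] g₂ = ω :=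
    ⟨_, _, one_tmul_cplxRe_add ω⟩
  obtain ⟨i1, i2⟩ := unitI_apply_of_mem_hodgeComponent_two_zero hω
  obtain ⟨b1, b2⟩ := baseChange_of_mem_hodgeComponent_two_zero hQ hs hω
  have hneg : Q.baseChange ℝ g₁ g₁ < 0 := by
    -- If `g₁` vanished, then `Q(g₂) = Q(g₁) = 0`, against positivity at `g₂ ≠ 0`.
    have hg : g₁ ≠ 0 := by
      rintro rfl
      have hg₂ : g₂ ≠ 0 := by
        rintro rfl
        simp at hω0
      have := hQ.pos g₂ hg₂
      rw [i2, map_neg, b1] at this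
      simp at this
    have := hQ.pos g₁ hg
    rw [i1, map_neg] at this
    linarith
  set r : ℝ := (√(-Q.baseChange ℝ g₁ g₁))⁻¹ with hr
  have hr0 : r ≠ 0 := inv_ne_zero (Real.sqrt_pos.2 (by linarith)).ne'
  have hr2 : r * (r * Q.baseChange ℝ g₁ g₁) = -1 := by
    have := Real.mul_self_sqrt (show 0 ≤ -Q.baseChange ℝ g₁ g₁ by linarith)
    have hne : √(-Q.baseChange ℝ g₁ g₁) ≠ 0 := (Real.sqrt_pos.2 (by linarith)).ne'
    rw [hr]
    field_simp
    linarith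
  refine ⟨r • g₁, r • g₂, ?_, ?_⟩
  · have : (1 : ℂ) ⊗ₜ[ℝ] (r • g₁) + Complex.I ⊗ₜ[ℝ] (r • g₂) =
        (r : ℂ) • ((1 : ℂ) ⊗ₜ[ℝ] g₁ + Complex.I ⊗ₜ[ℝ] g₂) := by
      rw [smul_one_tmul_add_I_tmul]
      simp
    rw [this, Submodule.span_singleton_smul_eq (Complex.ofReal_ne_zero.2 hr0).isUnit]
    refine le_antisymm (fun x hx => ?_) ?_
    · obtain ⟨c, hc⟩ := hspan ⟨x, hx⟩
      exact Submodule.mem_span_singleton.2 ⟨c, congrArg Subtype.val hc⟩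
    · rw [Submodule.span_singleton_le_iff_mem]
      exact hω
  · simpa using hr2

lemma IsAdapted.mem {h : ℂˣ → Module.End ℝ (RealExt V)} {Q : LinearMap.BilinForm ℚ V}
    {f₁ f₂ : RealExt V} (hf : IsAdapted h Q f₁ f₂) :
    (1 : ℂ) ⊗ₜ[ℝ] f₁ + Complex.I ⊗ₜ[ℝ] f₂ ∈ hodgeComponent h 2 0 := by
  rw [hf.span_eq]
  exact Submodule.mem_span_singleton_self _

/-- The generators differ by a complex scalar, of modulus one because of the normalization. It acts
on the pair as a rotation, which preserves the product. This is what lets one `ε` serve every pair.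
-/
lemma IsAdapted.realVecMul_eq {h : ℂˣ → Module.End ℝ (RealExt V)}
    {Q : LinearMap.BilinForm ℚ V} (hQ : IsPolarization 2 h Q) (hs : ∀ v w, Q v w = Q w v)
    {f₁ f₂ g₁ g₂ : RealExt V} (hf : IsAdapted h Q f₁ f₂) (hg : IsAdapted h Q g₁ g₂) :
    realVecMul Q g₁ g₂ = realVecMul Q f₁ f₂ := by
  have hmem := hg.mem
  rw [hf.span_eq, Submodule.mem_span_singleton] at hmem
  obtain ⟨c, hc⟩ := hmem
  rw [smul_one_tmul_add_I_tmul] at hc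
  obtain ⟨rfl, rfl⟩ := one_tmul_add_I_tmul_inj hc
  obtain ⟨b1, b2⟩ := baseChange_of_mem_hodgeComponent_two_zero hQ hs hf.mem
  have h12 := realVecMul_swap hs b2
  have hnorm := hg.norm_eq
  rw [hf.norm_eq] at b1
  simp only [map_sub, map_smul, LinearMap.sub_apply, LinearMap.smul_apply, smul_eq_mul,
    baseChange_symm hs f₂ f₁, b1, b2, hf.norm_eq] at hnorm
  simp only [map_add, map_sub, map_smul, LinearMap.sub_apply, LinearMap.smul_apply, h12,
    realVecMul_self hs, b1, hf.norm_eq]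
  have h1 : c.re ^ 2 + c.im ^ 2 = 1 := by linarith
  have : realVecMul Q f₁ f₂ = (c.re ^ 2 + c.im ^ 2) • realVecMul Q f₁ f₂ := by rw [h1, one_smul]
  conv_rhs => rw [this]
  module

lemma conj_conj (x : CplxExt V) : conj V (conj V x) = x := by
  induction x using TensorProduct.induction_on with
  | zero => simp
  | add x y hx hy => rw [map_add, map_add, hx, hy]
  | tmul z w => simp [conj]

lemma conj_smul (c : ℂ) (x : CplxExt V) :
    conj V (c • x) = (starRingEnd ℂ c) • conj V x := by
  induction x using TensorProduct.induction_on with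
  | zero => simp
  | add x y hx hy => rw [smul_add, map_add, hx, hy, map_add, smul_add]
  | tmul z w => simp [conj, TensorProduct.smul_tmul']

lemma conj_baseChange (T : Module.End ℝ (RealExt V)) (x : CplxExt V) :
    conj V (T.baseChange ℂ x) = T.baseChange ℂ (conj V x) := by
  induction x using TensorProduct.induction_on with
  | zero => simp
  | add x y hx hy => rw [map_add, map_add, hx, hy, map_add, map_add]
  | tmul z w => simp [conj]

/-- Since `h(i) = -T`, the components of type `(1,0)` and `(0,1)` are the eigenspaces of `T` for
`-i` and `i`. -/
lemma isHodgeStructure_one {h : ℂˣ → Module.End ℝ (RealExt V)} (T : Module.End ℝ (RealExt V))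
    (hT : T * T = -1) (hh : ∀ z : ℂˣ, h z = (z : ℂ).re • 1 - (z : ℂ).im • T) :
    IsHodgeStructure 1 h := by
  have hTT : ∀ x, T.baseChange ℂ (T.baseChange ℂ x) = -x := fun x => by
    rw [← LinearMap.comp_apply, ← LinearMap.baseChange_comp]
    change ((T * T).baseChange ℂ) x = -x
    rw [hT, LinearMap.baseChange_neg, Module.End.one_eq_id, LinearMap.baseChange_id]
    rfl
  have hbc : ∀ (z : ℂˣ) (x : CplxExt V), (h z).baseChange ℂ x =
      ((z : ℂ).re : ℂ) • x - ((z : ℂ).im : ℂ) • T.baseChange ℂ x := fun z x => by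
    rw [hh, LinearMap.baseChange_sub, LinearMap.baseChange_smul, LinearMap.baseChange_smul,
      Module.End.one_eq_id, LinearMap.baseChange_id, Complex.coe_smul, Complex.coe_smul]
    rfl
  have h10 : ∀ x, x ∈ hodgeComponent h 1 0 ↔ T.baseChange ℂ x = -(Complex.I • x) := fun x => by
    rw [mem_hodgeComponent]
    simp only [hbc, pow_one, pow_zero, mul_one]
    constructor
    · intro H
      have := H unitI
      simp only [unitI, Units.val_mk0, Complex.I_re, Complex.I_im, Complex.ofReal_zero,
        Complex.ofReal_one, zero_smul, one_smul, zero_sub] at this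
      rw [← this, neg_neg]
    · intro H z
      rw [H, smul_neg, sub_neg_eq_add, smul_smul, ← add_smul, Complex.re_add_im]
  have h01 : ∀ x, x ∈ hodgeComponent h 0 1 ↔ T.baseChange ℂ x = Complex.I • x := fun x => by
    rw [mem_hodgeComponent]
    simp only [hbc, pow_one, pow_zero, one_mul]
    constructor
    · intro H
      have := H unitI
      simp only [unitI, Units.val_mk0, Complex.I_re, Complex.I_im, Complex.ofReal_zero,
        Complex.ofReal_one, zero_smul, one_smul, zero_sub, Complex.conj_I, neg_smul] at this
      exact neg_injective this
    · intro H z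
      rw [H, smul_smul, ← sub_smul]
      congr 1
      apply Complex.ext <;> simp
  have hI : ∀ x : CplxExt V, Complex.I • Complex.I • x = -x := fun x => by
    rw [smul_smul, Complex.I_mul_I, neg_one_smul]
  refine ⟨?_, ?_, ?_, ?_⟩
  · simp [hh]
  · intro z w
    simp only [hh, Units.val_mul, Complex.mul_re, Complex.mul_im]
    have : ∀ a b c d : ℝ, (a • (1 : Module.End ℝ (RealExt V)) - b • T) * (c • 1 - d • T) =
        (a * c) • 1 - (a * d) • T - (b * c) • T + (b * d) • (T * T) := fun a b c d => by
      simp only [sub_mul, mul_sub, smul_mul_smul_comm, one_mul, mul_one]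
      abel
    rw [this, hT]
    module
  · rw [DirectSum.isInternal_submodule_iff_isCompl _ (i := (0 : Fin 2)) (j := (1 : Fin 2))
      (by decide) (by ext i; fin_cases i <;> simp)]
    change IsCompl (hodgeComponent h 0 1) (hodgeComponent h 1 0)
    refine ⟨Submodule.disjoint_def.2 fun x hx hx' => ?_, codisjoint_iff.2 ?_⟩
    · rw [h01] at hx
      rw [h10, hx, eq_neg_iff_add_eq_zero, ← two_smul ℂ, smul_smul] at hx'
      exact (smul_eq_zero.1 hx').resolve_left (mul_ne_zero two_ne_zero Complex.I_ne_zero)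
    -- The projectors `(1 ∓ iT)/2` onto the two eigenspaces.
    · refine eq_top_iff.2 fun x _ => Submodule.mem_sup.2
        ⟨(2⁻¹ : ℂ) • (x - Complex.I • T.baseChange ℂ x), ?_,
          (2⁻¹ : ℂ) • (x + Complex.I • T.baseChange ℂ x), ?_, ?_⟩
      · refine Submodule.smul_mem _ _ ((h01 _).2 ?_)
        rw [map_sub, map_smul, hTT, smul_sub, hI, smul_neg]
        abel
      · refine Submodule.smul_mem _ _ ((h10 _).2 ?_)
        rw [map_add, map_smul, hTT, smul_add, hI, smul_neg]
        abel
      · rw [← smul_add, sub_add_add_cancel, ← two_smul ℂ, smul_smul]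
        norm_num
  · have key : ∀ x, x ∈ hodgeComponent h 1 0 → conj V x ∈ hodgeComponent h 0 1 := fun x hx => by
      rw [h01, ← conj_baseChange, (h10 x).1 hx, map_neg, conj_smul, Complex.conj_I, neg_smul,
        neg_neg]
    have key' : ∀ x, x ∈ hodgeComponent h 0 1 → conj V x ∈ hodgeComponent h 1 0 := fun x hx => by
      rw [h10, ← conj_baseChange, (h01 x).1 hx, conj_smul, Complex.conj_I, neg_smul]
    intro p q hpq x
    obtain ⟨rfl, rfl⟩ | ⟨rfl, rfl⟩ : (p = 1 ∧ q = 0) ∨ (p = 0 ∧ q = 1) := by omega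
    · exact ⟨key x, fun hx => by simpa [conj_conj] using key' _ hx⟩
    · exact ⟨key' x, fun hx => by simpa [conj_conj] using key _ hx⟩

end HodgeComponent

/-! ### The weight one structure and its polarization. -/

section KugaSatakePolarization

variable {V : Type*} [AddCommGroup V] [Module ℚ V] {Q : LinearMap.BilinForm ℚ V}

lemma isHodgeStructure_hS {J : RealExt (CPlus Q)} (hJ : J * J = -1) :
    IsHodgeStructure 1 (hS Q J) := by
  refine isHodgeStructure_one (LinearMap.mulLeft ℝ J) ?_ fun z => ?_
  · refine LinearMap.ext fun x => ?_
    rw [Module.End.mul_apply, LinearMap.mulLeft_apply, LinearMap.mulLeft_apply, ← mul_assoc, hJ,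
      neg_one_mul]
    rfl
  · refine LinearMap.ext fun x => ?_
    simp only [hS, LinearMap.mulLeft_apply, sub_mul, smul_mul_assoc, one_mul, LinearMap.sub_apply,
      LinearMap.smul_apply, Module.End.one_apply]

lemma isPolarization_hS {α : CPlus Q} {J : RealExt (CPlus Q)} (hJ : J * J = -1)
    (hιJ : realIota Q J = -J) (hα : iota Q α = -α) (hTr : ∀ x, Tr Q (iota Q x) = Tr Q x)
    (hneg : TraceNegDef α J) : IsPolarization 1 (hS Q J) (formE Q α) := by
  have hI : ∀ v, hS Q J unitI v = -(J * v) := fun v => by simp [hS, unitI]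
  have hια : realIota Q ((1 : ℝ) ⊗ₜ α) = -((1 : ℝ) ⊗ₜ α) := by
    rw [realIota_tmul, hα, TensorProduct.tmul_neg]
  refine ⟨fun z v w => ?_, fun v w => ?_, fun v hv => ?_⟩
  · set a := (z : ℂ).re
    set b := (z : ℂ).im
    have hmul : (a • 1 + b • J) * (a • 1 - b • J) = Complex.normSq (z : ℂ) • 1 := by
      have : (a • 1 + b • J) * (a • 1 - b • J) = (a * a) • 1 - (b * b) • (J * J) := by
        simp only [add_mul, mul_sub, smul_mul_smul_comm, one_mul, mul_one, mul_comm a b]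
        abel
      rw [this, hJ, Complex.normSq_apply]
      module
    have hι : realIota Q (a • 1 - b • J) = a • 1 + b • J := by
      rw [map_sub, map_smul, map_smul, realIota_one, hιJ, smul_neg, sub_neg_eq_add]
    rw [formE_baseChange, formE_baseChange]
    simp only [hS, LinearMap.mulLeft_apply]
    rw [realIota_mul, hι]
    have : (1 : ℝ) ⊗ₜ α * (realIota Q v * (a • 1 + b • J)) * ((a • 1 - b • J) * w) =
        (1 : ℝ) ⊗ₜ α * realIota Q v * ((a • 1 + b • J) * (a • 1 - b • J)) * w := by
      simp only [mul_assoc]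
    rw [this, hmul, mul_smul_comm, mul_one, smul_mul_assoc, map_smul, pow_one, smul_eq_mul]
  -- Applying `ι` inside the trace turns `α ι(v) J w` into `ι(w) J v α`, the signs from `J` and `α`
  -- cancelling. Cyclicity then moves `α` to the front.
  · rw [formE_baseChange, formE_baseChange, hI, hI, ← realTr_realIota hTr]
    simp only [realIota_mul, map_neg, realIota_realIota, hιJ, hια, mul_neg, neg_mul, neg_neg]
    rw [← mul_assoc, realTr_mul_comm]
    simp only [mul_assoc]
  · rw [formE_baseChange, hI, mul_neg, map_neg]
    exact neg_pos.2 (hneg v hv)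

end KugaSatakePolarization

end

end KugaSatake

/-! ### The main theorem. -/

open KugaSatake in
theorem proposition5p9
    {V : Type*} [AddCommGroup V] [Module ℚ V] {m : ℕ}
    (h : ℂˣ → Module.End ℝ (RealExt V)) (Q : LinearMap.BilinForm ℚ V)
    (hh : IsHodgeStructure 2 h) (hQ : IsPolarization 2 h Q)
    (hdim : Module.finrank ℂ (hodgeComponent h 2 0) = 1)
    -- an orthogonal basis `e₁, …, e_n` (here numbered from `0`, with `n = m + 2`)
    (e : Module.Basis (Fin (m + 2)) ℚ V)
    (horth : ∀ i j, i ≠ j → Q (e i) (e j) = 0)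
    (hneg₁ : Q (e 0) (e 0) < 0) (hneg₂ : Q (e 1) (e 1) < 0)
    (hpos : ∀ i, i ≠ 0 → i ≠ 1 → 0 < Q (e i) (e i)) :
    (∃ f₁ f₂ : RealExt V, IsAdapted h Q f₁ f₂) ∧
    ∃ ε : ℚ, (ε = 1 ∨ ε = -1) ∧
      ∀ f₁ f₂ : RealExt V, IsAdapted h Q f₁ f₂ →
        IsHodgeStructure 1 (hS Q (realVecMul Q f₁ f₂)) ∧
        IsPolarization 1 (hS Q (realVecMul Q f₁ f₂))
          (formE Q (ε • vecMul Q (e 0) (e 1))) := by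
  -- Symmetry of `Q` is not assumed; it follows from diagonality in the basis `e`.
  have hs : ∀ v w, Q v w = Q w v := by
    have : Q = LinearMap.flip Q := by
      refine e.ext fun i => e.ext fun j => ?_
      rw [LinearMap.flip_apply]
      by_cases hij : i = j
      · rw [hij]
      · rw [horth i j hij, horth j i (Ne.symm hij)]
    exact fun v w => LinearMap.congr_fun₂ this v w
  have he : ∀ i j, i ≠ j → (quadForm Q).IsOrtho (e i) (e j) := fun i j hij =>
    isOrtho_quadForm hs (horth i j hij)
  have h01 : (0 : Fin (m + 2)) ≠ 1 := zero_ne_one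
  set α := vecMul Q (e 0) (e 1) with hα
  have hια : iota Q α = -α := by
    rw [hα, iota_vecMul, eq_neg_iff_add_eq_zero, vecMul_add_swap hs, horth 1 0 h01.symm]
    simp
  have hadapted := exists_isAdapted hQ hs hdim
  refine ⟨hadapted, ?_⟩
  have hortho : ∀ {f₁ f₂}, IsAdapted h Q f₁ f₂ →
      Q.baseChange ℝ f₂ f₂ = -1 ∧ Q.baseChange ℝ f₁ f₂ = 0 := fun hf => by
    have := baseChange_of_mem_hodgeComponent_two_zero hQ hs hf.mem
    rwa [hf.norm_eq] at this
  obtain ⟨g₁, g₂, hg⟩ := hadapted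
  have hdef : TraceDefinite α (realVecMul Q g₁ g₂) := by
    have hunit : ∀ {d : ℝ}, d < 0 → (√(-d))⁻¹ * (√(-d))⁻¹ * d = -1 := fun {d} hd => by
      have h1 := Real.mul_self_sqrt (show 0 ≤ -d by linarith)
      have h2 : √(-d) ≠ 0 := (Real.sqrt_pos.2 (by linarith)).ne'
      field_simp
      linarith
    have hneg₁' : (Q (e 0) (e 0) : ℝ) < 0 := by exact_mod_cast hneg₁
    have hneg₂' : (Q (e 1) (e 1) : ℝ) < 0 := by exact_mod_cast hneg₂
    -- The starting plane is that of `e 0` and `e 1`, normalized. Their product is a positive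
    -- multiple of `α`.
    refine TraceDefinite.of_orthonormal hs
      (p := (√(-(Q (e 0) (e 0) : ℝ)))⁻¹ ⊗ₜ e 0) (q := (√(-(Q (e 1) (e 1) : ℝ)))⁻¹ ⊗ₜ e 1)
      ?_ ?_ ?_ hg.norm_eq (hortho hg).1 (hortho hg).2 (Or.inl ?_)
    · rw [LinearMap.BilinForm.baseChange_tmul, Rat.smul_def, mul_comm]
      exact hunit hneg₁'
    · rw [LinearMap.BilinForm.baseChange_tmul, Rat.smul_def, mul_comm]
      exact hunit hneg₂'
    · rw [LinearMap.BilinForm.baseChange_tmul, horth 0 1 h01, zero_smul]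
    · rw [realVecMul_tmul, ← mul_one (_ * _), ← smul_eq_mul, ← TensorProduct.smul_tmul']
      refine traceNegDef_smul (mul_pos ?_ ?_) (traceNegDef_vecMul e he h01 hneg₁ hneg₂ hpos)
      · exact inv_pos.2 (Real.sqrt_pos.2 (by linarith))
      · exact inv_pos.2 (Real.sqrt_pos.2 (by linarith))
  -- The sign of `ε` is fixed once, from the reference pair `g₁, g₂`.
  obtain ⟨ε, hε, hneg⟩ : ∃ ε : ℚ, (ε = 1 ∨ ε = -1) ∧
      TraceNegDef (ε • α) (realVecMul Q g₁ g₂) := by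
    rcases hdef with hdef | hdef
    · exact ⟨1, Or.inl rfl, by rwa [one_smul]⟩
    · refine ⟨-1, Or.inr rfl, fun v hv => ?_⟩
      have := hdef v hv
      rwa [neg_mul, mul_neg, ← neg_mul, ← neg_mul, ← TensorProduct.tmul_neg,
        ← neg_one_smul ℚ α] at this
  refine ⟨ε, hε, fun f₁ f₂ hf => ?_⟩
  have hJ := realVecMul_mul_self hs hf.norm_eq (hortho hf).1 (hortho hf).2
  refine ⟨isHodgeStructure_hS hJ, isPolarization_hS hJ ?_ ?_ (Tr_iota e he) ?_⟩
  · rw [realIota_realVecMul, realVecMul_swap hs (hortho hf).2]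
  · rw [map_smul, hια, smul_neg]
  · rwa [hg.realVecMul_eq hQ hs hf]
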